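/- Let $D$ be an integral domain which is not a field, with quotient field $K$, and let $\star$ be a semistar operation on $D$, i.e. a map $E\mapsto E^\star$ from the set of nonzero $D$-submodules of $K$ to itself such that, for all nonzero $x\in K$ and all nonzero $D$-submodules $E,F$ of $K$: $(xE)^\star=xE^\star$; $E\subseteq F$ implies $E^\star\subseteq F^\star$; $E\subseteq E^\star$ and $(E^\star)^\star=E^\star$. Let $\star_f$ be the semistar operation of finite type associated to $\star$: $E^{\star_f}=\bigcup\{F^\star\mid F\subseteq E,\ F \text{ a nonzero finitely generated } D\text{-submodule}\}$. For a semistar operation $*$ on $D$, a quasi-$*$-ideal is a nonzero ideal $I$ of $D$ with $I=I^{*}\cap D$, and a quasi-$*$-maximal ideal is a maximal element of the set of proper quasi-$*$-ideals (such an ideal is prime). Let $\mathcal M(\star_f)$ be the set of quasi-$\star_f$-maximal ideals, and put $E^{\tilde\star}=\bigcap\{ED_Q\mid Q\in\mathcal M(\star_f)\}$ for every nonzero $D$-submodule $E$ of $K$ (this is $K$ if $\mathcal M(\star_f)=\emptyset$). The domain $D$ is called $\star$-Dedekind if it is $\star$-Noetherian (the quasi-$\star$-ideals of $D$ satisfy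 the ascending chain condition) and a P$\star$MD (every nonzero finitely generated ideal $I$ of $D$ satisfies $(II^{-1})^{\star_f}=D^{\star_f}$, where $I^{-1}=\{z\in K\mid zI\subseteq D\}$). Then the following are equivalent: 1. $D$ is $\star$-Dedekind. 2. For each nonzero ideal $I$ of $D$ and each nonzero $a\in I$ there exists $b\in I^{\tilde\star}$ such that $I^{\tilde\star}=((a,b)D)^{\tilde\star}$, where $(a,b)D=aD+bD\subseteq K$. -/

import Mathlib

open scoped Pointwise

/-- A semistar operation on an integral domain `D` with quotient field `K`: a map
`E ↦ E^⋆` on the set of nonzero `D`-submodules of `K` such that, for all nonzero `x ∈ K` and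
all nonzero `E, F`, `(xE)^⋆ = x E^⋆`, `E ⊆ F` implies `E^⋆ ⊆ F^⋆`, `E ⊆ E^⋆` and `E^⋆⋆ = E^⋆`.
The map is written as a total function; nothing is required of its value at the zero submodule,
and this value is never used. That `E^⋆` is nonzero for `E` nonzero follows from `E ⊆ E^⋆`. -/
structure SemistarOperation (D K : Type*) [CommRing D] [Field K] [Algebra D K] where
  toFun : Submodule D K → Submodule D K
  map_smul : ∀ (x : K) (E : Submodule D K), x ≠ 0 → E ≠ ⊥ → toFun (x • E) = x • toFun E
  mono : ∀ E F : Submodule D K, E ≠ ⊥ → E ≤ F → toFun E ≤ toFun F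
  le_map : ∀ E : Submodule D K, E ≠ ⊥ → E ≤ toFun E
  idem : ∀ E : Submodule D K, E ≠ ⊥ → toFun (toFun E) = toFun E

namespace SemistarOperation

variable {D K : Type*} [CommRing D] [Field K] [Algebra D K]

instance : CoeFun (SemistarOperation D K) (fun _ => Submodule D K → Submodule D K) :=
  ⟨SemistarOperation.toFun⟩

theorem smul_ne_bot {x : K} (hx : x ≠ 0) {E : Submodule D K} (hE : E ≠ ⊥) : x • E ≠ ⊥ := by
  obtain ⟨e, he, he0⟩ := (Submodule.ne_bot_iff E).1 hE
  exact (Submodule.ne_bot_iff _).2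
    ⟨x • e, Submodule.smul_mem_pointwise_smul e x E he, mul_ne_zero hx he0⟩

theorem map_ne_bot (s : SemistarOperation D K) {E : Submodule D K} (hE : E ≠ ⊥) : s E ≠ ⊥ :=
  ne_bot_of_le_ne_bot hE (s.le_map E hE)

/-- A one-sided scaling inequality for all nonzero scalars gives the equality. -/
theorem smul_eq_of_le {f : Submodule D K → Submodule D K}
    (h : ∀ (x : K) (E : Submodule D K), x ≠ 0 → E ≠ ⊥ → x • f E ≤ f (x • E))
    (x : K) (E : Submodule D K) (hx : x ≠ 0) (hE : E ≠ ⊥) : f (x • E) = x • f E := by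
  refine le_antisymm ?_ (h x E hx hE)
  have h1 := h x⁻¹ (x • E) (inv_ne_zero hx) (smul_ne_bot hx hE)
  rw [smul_smul, inv_mul_cancel₀ hx, one_smul] at h1
  intro z hz
  have h2 := h1 (Submodule.smul_mem_pointwise_smul z x⁻¹ _ hz)
  have h3 := Submodule.smul_mem_pointwise_smul _ x _ h2
  rwa [smul_smul, mul_inv_cancel₀ hx, one_smul] at h3

/-! ### The semistar operation of finite type associated to a semistar operation -/

/-- The submodules `F^⋆`, for `F` a nonzero finitely generated submodule of `E`. -/
def finiteTypeSet (s : SemistarOperation D K) (E : Submodule D K) : Set (Submodule D K) :=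
  {G | ∃ F : Submodule D K, F ≠ ⊥ ∧ F.FG ∧ F ≤ E ∧ s F = G}

theorem finiteTypeSet_nonempty (s : SemistarOperation D K) {E : Submodule D K} (hE : E ≠ ⊥) :
    (s.finiteTypeSet E).Nonempty := by
  obtain ⟨e, he, he0⟩ := (Submodule.ne_bot_iff E).1 hE
  exact ⟨_, Submodule.span D {e}, by simpa using he0, Submodule.fg_span_singleton e,
    by simpa using he, rfl⟩

theorem finiteTypeSet_directedOn (s : SemistarOperation D K) (E : Submodule D K) :
    DirectedOn (· ≤ ·) (s.finiteTypeSet E) := by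
  rintro _ ⟨F, hF0, hF, hFE, rfl⟩ _ ⟨G, hG0, hG, hGE, rfl⟩
  exact ⟨s (F ⊔ G), ⟨F ⊔ G, ne_bot_of_le_ne_bot hF0 le_sup_left, hF.sup hG,
    sup_le hFE hGE, rfl⟩, s.mono _ _ hF0 le_sup_left, s.mono _ _ hG0 le_sup_right⟩

/-- The supremum of the `F^⋆` is their union. -/
theorem mem_sSup_finiteTypeSet (s : SemistarOperation D K) {E : Submodule D K} (hE : E ≠ ⊥)
    {z : K} : z ∈ sSup (s.finiteTypeSet E) ↔
      ∃ F : Submodule D K, F ≠ ⊥ ∧ F.FG ∧ F ≤ E ∧ z ∈ s F := by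
  rw [Submodule.mem_sSup_of_directed (s.finiteTypeSet_nonempty hE)
    (s.finiteTypeSet_directedOn E)]
  constructor
  · rintro ⟨_, ⟨F, h1, h2, h3, rfl⟩, hz⟩
    exact ⟨F, h1, h2, h3, hz⟩
  · rintro ⟨F, h1, h2, h3, hz⟩
    exact ⟨_, ⟨F, h1, h2, h3, rfl⟩, hz⟩

theorem le_sSup_finiteTypeSet (s : SemistarOperation D K) {E : Submodule D K} (hE : E ≠ ⊥) :
    E ≤ sSup (s.finiteTypeSet E) := by
  intro z hz
  rcases eq_or_ne z 0 with rfl | hz0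
  · exact zero_mem _
  · have h0 : Submodule.span D {z} ≠ ⊥ := by simpa using hz0
    exact (s.mem_sSup_finiteTypeSet hE).2 ⟨Submodule.span D {z}, h0,
      Submodule.fg_span_singleton z, by simpa using hz,
      s.le_map _ h0 (Submodule.mem_span_singleton_self z)⟩

/-- `⋆_f`, the semistar operation of finite type associated to `⋆`:
`E^{⋆_f}` is the union of the `F^⋆`, for `F ⊆ E` nonzero and finitely generated. -/
def finiteType (s : SemistarOperation D K) : SemistarOperation D K where
  toFun E := sSup (s.finiteTypeSet E)
  map_smul := by
    refine smul_eq_of_le (f := fun E => sSup (s.finiteTypeSet E)) ?_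
    intro x E hx hE z hz
    obtain ⟨w, hw, rfl⟩ := (Submodule.mem_smul_pointwise_iff_exists _ _ _).1 hz
    obtain ⟨F, h1, h2, h3, h4⟩ := (s.mem_sSup_finiteTypeSet hE).1 hw
    refine (s.mem_sSup_finiteTypeSet (smul_ne_bot hx hE)).2 ⟨x • F, smul_ne_bot hx h1, ?_, ?_, ?_⟩
    · exact h2.map _
    · exact smul_mono_right x h3
    · rw [s.map_smul x F hx h1]
      exact Submodule.smul_mem_pointwise_smul _ _ _ h4
  mono := by
    intro E F _ hEF
    refine sSup_le_sSup ?_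
    rintro _ ⟨G, h1, h2, h3, rfl⟩
    exact ⟨G, h1, h2, h3.trans hEF, rfl⟩
  le_map E hE := s.le_sSup_finiteTypeSet hE
  idem := by
    intro E hE
    have hE' : sSup (s.finiteTypeSet E) ≠ ⊥ :=
      ne_bot_of_le_ne_bot hE (s.le_sSup_finiteTypeSet hE)
    refine le_antisymm ?_ (s.le_sSup_finiteTypeSet hE')
    refine sSup_le ?_
    rintro _ ⟨F, h1, h2, h3, rfl⟩
    have hc := (Submodule.fg_iff_compact F).1 h2
    obtain ⟨_, ⟨G, g1, g2, g3, rfl⟩, hG⟩ :=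
      (CompleteLattice.isCompactElement_iff_le_of_directed_sSup_le _ F).1 hc
        _ (s.finiteTypeSet_nonempty hE) (s.finiteTypeSet_directedOn E) h3
    refine (s.mono F (s G) h1 hG).trans ?_
    rw [s.idem G g1]
    exact le_sSup ⟨G, g1, g2, g3, rfl⟩

/-! ### Quasi-`⋆`-ideals -/

/-- The contraction `E ∩ D` to `D` of a submodule `E` of `K`. -/
def contract (E : Submodule D K) : Ideal D :=
  Submodule.comap (Algebra.linearMap D K) E

/-- A quasi-`⋆`-ideal of `D`: a nonzero ideal `I` such that `I = I^⋆ ∩ D`. -/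
def IsQuasiIdeal (s : SemistarOperation D K) (I : Ideal D) : Prop :=
  I ≠ ⊥ ∧ I = contract (s (IsLocalization.coeSubmodule K I))

/-- A quasi-`⋆`-maximal ideal of `D`: a maximal element of the set of proper quasi-`⋆`-ideals. -/
def IsQuasiMaximal (s : SemistarOperation D K) (Q : Ideal D) : Prop :=
  Maximal (fun I : Ideal D => I ≠ ⊤ ∧ s.IsQuasiIdeal I) Q

/-- Every quasi-`⋆`-maximal ideal is prime, so that it is a point of the spectrum of `D`. -/
theorem IsQuasiMaximal.isPrime [IsFractionRing D K] {s : SemistarOperation D K} {Q : Ideal D}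
    (hQ : s.IsQuasiMaximal Q) : Q.IsPrime := by
  have hinj : Function.Injective (algebraMap D K) := IsFractionRing.injective D K
  have hne : ∀ {I : Ideal D}, I ≠ ⊥ → IsLocalization.coeSubmodule K I ≠ ⊥ := by
    intro I hI h
    obtain ⟨a, ha, ha0⟩ := (Submodule.ne_bot_iff I).1 hI
    have : algebraMap D K a ∈ IsLocalization.coeSubmodule K I := ⟨a, ha, rfl⟩
    rw [h, Submodule.mem_bot] at this
    exact ha0 (hinj (by simpa using this))
  obtain ⟨⟨hQt, hQ0, hQe⟩, hmax⟩ := hQ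
  refine ⟨hQt, ?_⟩
  intro a b hab
  by_contra! hcon
  obtain ⟨ha, hb⟩ := hcon
  have hb0 : algebraMap D K b ≠ 0 := by
    intro h
    exact hb ((hinj (h.trans (map_zero _).symm)) ▸ zero_mem Q)
  set J : Ideal D := Q ⊔ Ideal.span {a} with hJ
  have hJ0 : J ≠ ⊥ := ne_bot_of_le_ne_bot hQ0 le_sup_left
  have hJK := hne hJ0
  have hJle : J ≤ contract (s (IsLocalization.coeSubmodule K J)) := fun y hy =>
    s.le_map _ hJK ⟨y, hy, rfl⟩
  have haJ : a ∈ J := le_sup_right (a := Q) (Ideal.mem_span_singleton_self a)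
  have hone : (1 : D) ∈ contract (s (IsLocalization.coeSubmodule K J)) := by
    by_contra h1
    have hI0 := ne_bot_of_le_ne_bot hJ0 hJle
    have hq : s.IsQuasiIdeal (contract (s (IsLocalization.coeSubmodule K J))) := by
      refine ⟨hI0, le_antisymm (fun y hy => s.le_map _ (hne hI0) ⟨y, hy, rfl⟩) ?_⟩
      have hle : IsLocalization.coeSubmodule K
          (contract (s (IsLocalization.coeSubmodule K J))) ≤
          s (IsLocalization.coeSubmodule K J) := by
        rintro _ ⟨y, hy, rfl⟩
        exact hy
      have := s.mono _ _ (hne hI0) hle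
      rw [s.idem _ hJK] at this
      exact fun y hy => this hy
    exact ha (hmax ⟨(Ideal.ne_top_iff_one _).2 h1, hq⟩ (le_sup_left.trans hJle) (hJle haJ))
  have hbJ : algebraMap D K b • IsLocalization.coeSubmodule K J ≤
      IsLocalization.coeSubmodule K Q := by
    intro z hz
    obtain ⟨_, ⟨y, hy, rfl⟩, rfl⟩ := (Submodule.mem_smul_pointwise_iff_exists _ _ _).1 hz
    obtain ⟨q, hq, r, hr, rfl⟩ := Submodule.mem_sup.1 hy
    obtain ⟨c, rfl⟩ := Ideal.mem_span_singleton'.1 hr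
    refine ⟨b * (q + c * a), ?_, by simp [Algebra.linearMap_apply]⟩
    have : b * (q + c * a) = b * q + c * (a * b) := by ring
    rw [this]
    exact add_mem (Ideal.mul_mem_left _ _ hq) (Ideal.mul_mem_left _ _ hab)
  apply hb
  rw [hQe]
  have h2 := s.mono _ _ (smul_ne_bot hb0 hJK) hbJ
  rw [s.map_smul _ _ hb0 hJK] at h2
  have h3 := h2 (Submodule.smul_mem_pointwise_smul _ (algebraMap D K b) _ hone)
  change algebraMap D K b ∈ s (IsLocalization.coeSubmodule K Q)
  simpa [Algebra.linearMap_apply] using h3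

/-! ### Spectral semistar operations -/

section Spectral

variable [IsDomain D] [IsFractionRing D K]

/-- The localization `D_P`, as a subring of `K` containing `D`. -/
noncomputable def localizationAt (K : Type*) [Field K] [Algebra D K] [IsFractionRing D K]
    (P : PrimeSpectrum D) : Subalgebra D K :=
  Localization.subalgebra.ofField K P.asIdeal.primeCompl P.asIdeal.primeCompl_le_nonZeroDivisors

/-- The extension `E D_P` of a `D`-submodule `E` of `K`. -/
noncomputable def extend (P : PrimeSpectrum D) (E : Submodule D K) : Submodule D K :=
  E * Subalgebra.toSubmodule (localizationAt K P)

theorem le_extend (P : PrimeSpectrum D) (E : Submodule D K) : E ≤ extend P E := by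
  intro z hz
  have := Submodule.mul_mem_mul hz
    (show (1 : K) ∈ Subalgebra.toSubmodule (localizationAt K P) from one_mem (localizationAt K P))
  rwa [mul_one] at this

theorem extend_mono (P : PrimeSpectrum D) {E F : Submodule D K} (h : E ≤ F) :
    extend P E ≤ extend P F :=
  mul_le_mul' h le_rfl

theorem extend_extend (P : PrimeSpectrum D) (E : Submodule D K) :
    extend P (extend P E) = extend P E := by
  unfold extend
  rw [mul_assoc, Subalgebra.isIdempotentElem_toSubmodule]

theorem smul_extend (P : PrimeSpectrum D) (x : K) (E : Submodule D K) :
    x • extend P E ≤ extend P (x • E) := by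
  intro z hz
  obtain ⟨w, hw, rfl⟩ := (Submodule.mem_smul_pointwise_iff_exists _ _ _).1 hz
  refine Submodule.mul_induction_on hw ?_ ?_
  · intro m hm n hn
    rw [smul_eq_mul, ← mul_assoc]
    exact Submodule.mul_mem_mul (Submodule.smul_mem_pointwise_smul m x E hm) hn
  · intro u v hu hv
    rw [smul_add]
    exact add_mem hu hv

/-- The spectral semistar operation `⋆_Δ` defined by a set `Δ` of prime ideals of `D`:
`E^{⋆_Δ}` is the intersection of the `E D_P`, for `P ∈ Δ` (it is `K` if `Δ` is empty). -/
noncomputable def spectral (Δ : Set (PrimeSpectrum D)) : SemistarOperation D K where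
  toFun E := ⨅ P ∈ Δ, extend P E
  map_smul := by
    refine smul_eq_of_le (f := fun E => ⨅ P ∈ Δ, extend P E) ?_
    intro x E _ _
    refine le_iInf₂ fun P hP => ?_
    exact (smul_mono_right x (iInf₂_le P hP)).trans (smul_extend P x E)
  mono E F _ h := iInf₂_mono fun P _ => extend_mono P h
  le_map E _ := le_iInf₂ fun P _ => le_extend P E
  idem := by
    intro E _
    refine le_antisymm ?_ (le_iInf₂ fun P _ => le_extend P _)
    refine le_iInf₂ fun P hP => ?_
    refine (iInf₂_le P hP).trans ?_
    exact (extend_mono P (iInf₂_le P hP)).trans (extend_extend P E).le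

/-- `⋆~`, the spectral semistar operation defined by the set of the quasi-`⋆_f`-maximal ideals:
`E^{⋆~}` is the intersection of the `E D_Q`, for `Q` quasi-`⋆_f`-maximal. (All these ideals are
prime, by `IsQuasiMaximal.isPrime`.) -/
noncomputable def tilde (s : SemistarOperation D K) : SemistarOperation D K :=
  spectral {Q : PrimeSpectrum D | s.finiteType.IsQuasiMaximal Q.asIdeal}

end Spectral

/-! ### `⋆`-Noetherian domains, P`⋆`MDs and `⋆`-Dedekind domains -/

/-- `D` is `⋆`-Noetherian: the ascending chain condition on quasi-`⋆`-ideals. -/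
def IsNoetherianDomain (s : SemistarOperation D K) : Prop :=
  ∀ I : ℕ →o Ideal D, (∀ n, s.IsQuasiIdeal (I n)) → ∃ n, ∀ m, n ≤ m → I n = I m

/-- A `⋆`-invertible ideal `I` of `D`: `(I I⁻¹)^⋆ = D^⋆`, where `I⁻¹ = (D :_K I)`. -/
def IsInvertibleIdeal (s : SemistarOperation D K) (I : Ideal D) : Prop :=
  s (IsLocalization.coeSubmodule K I * (1 / IsLocalization.coeSubmodule K I)) = s 1

/-- `D` is a P`⋆`MD (Prüfer semistar multiplication domain): each nonzero finitely generated
ideal is `⋆_f`-invertible. -/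
def IsPruferMultiplicationDomain (s : SemistarOperation D K) : Prop :=
  ∀ I : Ideal D, I ≠ ⊥ → I.FG → s.finiteType.IsInvertibleIdeal I

/-- `D` is a `⋆`-Dedekind domain: it is `⋆`-Noetherian and a P`⋆`MD. -/
def IsDedekindDomain (s : SemistarOperation D K) : Prop :=
  s.IsNoetherianDomain ∧ s.IsPruferMultiplicationDomain

end SemistarOperation

/-!
Both conditions are read off from the localizations `D_Q`, for `Q` quasi-`⋆_f`-maximal. By Zorn's
lemma a nonzero ideal that lies in no such `Q` has a `⋆_f`-closure containing `1`
(`one_mem_finiteType_of_not_le`); in particular `E^⋆~ ⊆ E^⋆_f` (`tilde_le_finiteType`). Statements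
about `D_Q` are phrased inside `D`: `x` generates `I D_Q` if `x ∈ I` and for each `y ∈ I` there is
some `t ∉ Q` with `x ∣ t * y`.

Let `D` be `⋆`-Dedekind. By the chain condition each nonzero ideal `I` has the same `⋆`-closure as
some finitely generated `J ⊆ I`, and by invertibility of the ideals `J + yD` it has the same
extension to each `D_Q` (`IsDedekindDomain.exists_mul_mem`), which is principal
(`IsDedekindDomain.exists_local_generator`). Hence a nonzero `a` divides, in `D_Q`, a power of a
generator of `Q D_Q`, and this gives for each `Q` an element outside `Q` lying in all the other
`Q' ∋ a` (`IsDedekindDomain.exists_separating`). The ideal generated by `a` and these separating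
elements is locally the unit ideal, and finitely many generators suffice for that, so only finitely
many `Q` contain `a` (`IsDedekindDomain.finite_setOf_mem`). A Chinese remainder argument then
yields `b ∈ I` generating `I D_Q` for all these `Q`
(`IsDedekindDomain.exists_common_generator`); where `a ∉ Q`, the element `a` does so itself.

Conversely, choosing `a ∈ QI` in the two-generator condition forces `I D_Q = b D_Q` as in Nakayama's
lemma (`exists_local_generator_of_tilde_eq_span_pair`). For `I` finitely generated this puts
`I I⁻¹` outside every `Q`, so `I` is `⋆_f`-invertible. Applied to the union of a chain of
quasi-`⋆`-ideals, with `a` in the first of them, the condition gives a `b` that already lies in the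
`⋆`-closure of a member, so the chain stops.
-/

namespace SemistarOperation

variable {D K : Type*} [CommRing D] [Field K] [Algebra D K]

/-! ### Ideals of `D` as submodules of `K` -/

theorem coeSubmodule_contract {E : Submodule D K} (hE : E ≤ 1) :
    IsLocalization.coeSubmodule K (contract E) = E := by
  refine le_antisymm ?_ fun z hz => ?_
  · rintro _ ⟨y, hy, rfl⟩
    exact hy
  · obtain ⟨y, rfl⟩ := Submodule.mem_one.1 (hE hz)
    exact ⟨y, hz, rfl⟩

theorem contract_ne_bot {E : Submodule D K} (h0 : E ≠ ⊥) (hE : E ≤ 1) : contract E ≠ ⊥ := by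
  intro h
  have := coeSubmodule_contract hE
  rw [h, IsLocalization.coeSubmodule_bot] at this
  exact h0 this.symm

theorem coeSubmodule_le_one (I : Ideal D) : IsLocalization.coeSubmodule K I ≤ 1 := by
  rintro _ ⟨y, -, rfl⟩
  exact Submodule.mem_one.2 ⟨y, rfl⟩

theorem coeSubmodule_mono {I J : Ideal D} (h : I ≤ J) :
    IsLocalization.coeSubmodule K I ≤ IsLocalization.coeSubmodule K J :=
  Submodule.map_mono h

theorem one_ne_bot : (1 : Submodule D K) ≠ ⊥ :=
  (Submodule.ne_bot_iff _).2 ⟨1, Submodule.one_le.1 le_rfl, one_ne_zero⟩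

/-- Multiplication by a fixed submodule is compatible with the closure on the other factor. -/
theorem map_mul_le_map_mul (s : SemistarOperation D K) {E : Submodule D K} (hE : E ≠ ⊥)
    (F : Submodule D K) : s E * F ≤ s (E * F) := by
  refine Submodule.mul_le.2 fun m hm z hz => ?_
  rcases eq_or_ne z 0 with rfl | hz0
  · simp
  have h : z • E ≤ E * F := by
    intro w hw
    obtain ⟨v, hv, rfl⟩ := (Submodule.mem_smul_pointwise_iff_exists _ _ _).1 hw
    rw [smul_eq_mul, mul_comm z v]
    exact Submodule.mul_mem_mul hv hz
  have h2 := s.mono _ _ (smul_ne_bot hz0 hE) h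
  rw [s.map_smul z E hz0 hE] at h2
  rw [mul_comm m z]
  exact h2 (Submodule.smul_mem_pointwise_smul m z _ hm)

/-- If the closure of `I` contains `1`, then an element that `I` multiplies into `E` lies in the
closure of `E`. -/
theorem mem_of_one_mem (s : SemistarOperation D K) {I E : Submodule D K} (hI : I ≠ ⊥)
    (h1 : (1 : K) ∈ s I) {z : K} (h : ∀ y ∈ I, z * y ∈ E) : z ∈ s E := by
  rcases eq_or_ne z 0 with rfl | hz0
  · exact zero_mem _
  have hle : z • I ≤ E := by
    intro w hw
    obtain ⟨v, hv, rfl⟩ := (Submodule.mem_smul_pointwise_iff_exists _ _ _).1 hw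
    exact h v hv
  have h2 := s.mono _ _ (smul_ne_bot hz0 hI) hle
  rw [s.map_smul z I hz0 hI] at h2
  simpa using h2 (Submodule.smul_mem_pointwise_smul 1 z _ h1)

theorem finiteType_le (s : SemistarOperation D K) {E : Submodule D K} (hE : E ≠ ⊥) :
    s.finiteType E ≤ s E := by
  intro z hz
  obtain ⟨F, h1, -, h3, h4⟩ := (s.mem_sSup_finiteTypeSet hE).1 hz
  exact s.mono _ _ h1 h3 h4

section FractionRing

variable [IsFractionRing D K]

theorem coeSubmodule_ne_bot {I : Ideal D} (hI : I ≠ ⊥) : IsLocalization.coeSubmodule K I ≠ ⊥ := by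
  obtain ⟨a, ha, ha0⟩ := (Submodule.ne_bot_iff I).1 hI
  refine (Submodule.ne_bot_iff _).2 ⟨algebraMap D K a, ⟨a, ha, rfl⟩, fun h => ha0 ?_⟩
  exact IsFractionRing.injective D K (h.trans (map_zero _).symm)

theorem algebraMap_mem_coeSubmodule {I : Ideal D} {y : D} :
    algebraMap D K y ∈ IsLocalization.coeSubmodule K I ↔ y ∈ I := by
  refine ⟨?_, fun h => ⟨y, h, rfl⟩⟩
  rintro ⟨x, hx, h⟩
  exact IsFractionRing.injective D K h ▸ hx

theorem le_contract_map (s : SemistarOperation D K) {I : Ideal D} (hI : I ≠ ⊥) :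
    I ≤ contract (s (IsLocalization.coeSubmodule K I)) :=
  fun y hy => s.le_map _ (coeSubmodule_ne_bot hI) ⟨y, hy, rfl⟩

theorem isQuasiIdeal_contract (s : SemistarOperation D K) {I : Ideal D} (hI : I ≠ ⊥) :
    s.IsQuasiIdeal (contract (s (IsLocalization.coeSubmodule K I))) := by
  have h0 := ne_bot_of_le_ne_bot hI (s.le_contract_map hI)
  refine ⟨h0, le_antisymm (s.le_contract_map h0) ?_⟩
  have hle : IsLocalization.coeSubmodule K (contract (s (IsLocalization.coeSubmodule K I))) ≤
      s (IsLocalization.coeSubmodule K I) := by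
    rintro _ ⟨y, hy, rfl⟩
    exact hy
  have := s.mono _ _ (coeSubmodule_ne_bot h0) hle
  rw [s.idem _ (coeSubmodule_ne_bot hI)] at this
  exact fun y hy => this hy

theorem mem_finiteType_coeSubmodule (s : SemistarOperation D K) {I : Ideal D} (hI : I ≠ ⊥)
    {z : K} : z ∈ s.finiteType (IsLocalization.coeSubmodule K I) ↔
      ∃ J : Ideal D, J ≠ ⊥ ∧ J.FG ∧ J ≤ I ∧ z ∈ s (IsLocalization.coeSubmodule K J) := by
  refine (s.mem_sSup_finiteTypeSet (coeSubmodule_ne_bot hI)).trans ⟨?_, ?_⟩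
  · rintro ⟨F, h0, hF, hFI, hz⟩
    have hFe := coeSubmodule_contract (hFI.trans (coeSubmodule_le_one I))
    refine ⟨contract F, contract_ne_bot h0 (hFI.trans (coeSubmodule_le_one I)), ?_, ?_,
      by rwa [hFe]⟩
    · refine (IsLocalization.coeSubmodule_fg K (IsFractionRing.injective D K) _).1 ?_
      rwa [hFe]
    · exact fun y hy => algebraMap_mem_coeSubmodule.1 (hFI hy)
  · rintro ⟨J, h0, hJ, hJI, hz⟩
    exact ⟨_, coeSubmodule_ne_bot h0,
      (IsLocalization.coeSubmodule_fg K (IsFractionRing.injective D K) J).2 hJ,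
      coeSubmodule_mono hJI, hz⟩

/-- A finitely generated ideal below the union of a directed family lies below a member. -/
theorem _root_.Ideal.FG.exists_le_of_le_sSup {J : Ideal D} (hJ : J.FG) {c : Set (Ideal D)}
    (hc : c.Nonempty) (hd : DirectedOn (· ≤ ·) c) (h : J ≤ sSup c) : ∃ I ∈ c, J ≤ I :=
  (CompleteLattice.isCompactElement_iff_le_of_directed_sSup_le _ J).1
    ((Submodule.fg_iff_compact J).1 hJ) _ hc hd h

/-! ### Quasi-`⋆_f`-maximal ideals -/

theorem IsQuasiMaximal.not_le {s : SemistarOperation D K} {Q : Ideal D} (hQ : s.IsQuasiMaximal Q)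
    {H : Ideal D} (h0 : H ≠ ⊥) (h1 : (1 : K) ∈ s (IsLocalization.coeSubmodule K H)) :
    ¬ H ≤ Q := by
  intro hle
  refine (Ideal.ne_top_iff_one _).1 hQ.prop.1 ?_
  rw [hQ.prop.2.2]
  have := s.mono _ _ (coeSubmodule_ne_bot h0) (coeSubmodule_mono hle) h1
  simpa [contract] using this

theorem exists_isQuasiMaximal_ge (s : SemistarOperation D K) {H : Ideal D} (hH : H ≠ ⊤)
    (hq : s.finiteType.IsQuasiIdeal H) : ∃ Q, H ≤ Q ∧ s.finiteType.IsQuasiMaximal Q := by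
  refine zorn_le_nonempty₀ {I : Ideal D | I ≠ ⊤ ∧ s.finiteType.IsQuasiIdeal I} ?_ H ⟨hH, hq⟩
  intro c hc hchain I hI
  have hd : DirectedOn (· ≤ ·) c := hchain.directedOn
  have h0 : sSup c ≠ ⊥ := ne_bot_of_le_ne_bot (hc hI).2.1 (le_sSup hI)
  refine ⟨sSup c, ⟨?_, h0, le_antisymm (s.finiteType.le_contract_map h0) ?_⟩,
    fun z hz => le_sSup hz⟩
  · rw [Ideal.ne_top_iff_one]
    intro h
    obtain ⟨J, hJ, h1⟩ := (Submodule.mem_sSup_of_directed ⟨I, hI⟩ hd).1 h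
    exact (Ideal.ne_top_iff_one _).1 (hc hJ).1 h1
  · intro y hy
    obtain ⟨J, hJ0, hJ, hJc, hyJ⟩ := (s.mem_finiteType_coeSubmodule h0).1 hy
    obtain ⟨I', hI', hJI⟩ := hJ.exists_le_of_le_sSup ⟨I, hI⟩ hd hJc
    refine le_sSup hI' ?_
    rw [(hc hI').2.2]
    exact (s.mem_finiteType_coeSubmodule (hc hI').2.1).2 ⟨J, hJ0, hJ, hJI, hyJ⟩

/-- A nonzero ideal contained in no quasi-`⋆_f`-maximal ideal has a closure containing `1`. -/
theorem one_mem_finiteType_of_not_le (s : SemistarOperation D K) {H : Ideal D} (h0 : H ≠ ⊥)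
    (h : ∀ Q : PrimeSpectrum D, s.finiteType.IsQuasiMaximal Q.asIdeal → ¬ H ≤ Q.asIdeal) :
    (1 : K) ∈ s.finiteType (IsLocalization.coeSubmodule K H) := by
  by_contra h1
  have hne : contract (s.finiteType (IsLocalization.coeSubmodule K H)) ≠ ⊤ := by
    rw [Ideal.ne_top_iff_one]
    simpa [contract] using h1
  obtain ⟨Q, hle, hQ⟩ := s.exists_isQuasiMaximal_ge hne (s.finiteType.isQuasiIdeal_contract h0)
  exact h ⟨Q, hQ.isPrime⟩ hQ ((s.finiteType.le_contract_map h0).trans hle)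

end FractionRing

section Tilde

variable [IsDomain D] [IsFractionRing D K]

/-- An element lies in `E D_P` exactly when some denominator outside `P` takes it into `E`. -/
theorem mem_extend_iff {P : PrimeSpectrum D} {E : Submodule D K} {z : K} :
    z ∈ extend P E ↔ ∃ t ∉ P.asIdeal, t • z ∈ E := by
  have hinj : ∀ {t : D}, t ∉ P.asIdeal → algebraMap D K t ≠ 0 := fun {t} ht h =>
    ht ((IsFractionRing.injective D K (h.trans (map_zero _).symm)) ▸ zero_mem P.asIdeal)
  constructor
  · intro hz
    refine Submodule.mul_induction_on hz ?_ ?_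
    · rintro m hm _ ⟨d, t, ht, rfl⟩
      refine ⟨t, ht, ?_⟩
      have : t • (m * (algebraMap D K d * (algebraMap D K t)⁻¹)) = d • m := by
        rw [Algebra.smul_def, Algebra.smul_def]
        field_simp [hinj ht]
      rw [this]
      exact E.smul_mem d hm
    · rintro x y ⟨t, ht, hx⟩ ⟨u, hu, hy⟩
      refine ⟨t * u, P.isPrime.mul_notMem ht hu, ?_⟩
      rw [smul_add]
      refine add_mem ?_ ?_
      · rw [mul_comm, mul_smul]
        exact E.smul_mem u hx
      · rw [mul_smul]
        exact E.smul_mem t hy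
  · rintro ⟨t, ht, h⟩
    have : z = (t • z) * (algebraMap D K 1 * (algebraMap D K t)⁻¹) := by
      rw [Algebra.smul_def]
      have := hinj ht
      field_simp
      simp
    rw [this]
    exact Submodule.mul_mem_mul h ⟨1, t, ht, rfl⟩

theorem mem_tilde_iff (s : SemistarOperation D K) {E : Submodule D K} {z : K} :
    z ∈ s.tilde E ↔ ∀ Q : PrimeSpectrum D, s.finiteType.IsQuasiMaximal Q.asIdeal →
      ∃ t ∉ Q.asIdeal, t • z ∈ E := by
  change z ∈ (⨅ P ∈ {Q : PrimeSpectrum D | s.finiteType.IsQuasiMaximal Q.asIdeal},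
    extend P E) ↔ _
  simp only [Submodule.mem_iInf, mem_extend_iff, Set.mem_ofPred_eq]

/-- The inclusion `E^⋆~ ⊆ E^⋆_f`: the conductor of `z ∈ E^⋆~` into `E` lies in no
quasi-`⋆_f`-maximal ideal, so its `⋆_f`-closure contains `1`. -/
theorem tilde_le_finiteType (s : SemistarOperation D K) {E : Submodule D K} (hE : E ≠ ⊥) :
    s.tilde E ≤ s.finiteType E := by
  intro z hz
  rw [mem_tilde_iff] at hz
  let H : Ideal D := Submodule.comap (LinearMap.toSpanSingleton D K z) E
  have hH : ∀ {t : D}, t ∈ H ↔ t • z ∈ E := Iff.rfl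
  have h0 : H ≠ ⊥ := by
    obtain ⟨e, he, he0⟩ := (Submodule.ne_bot_iff E).1 hE
    obtain ⟨p, q, hq, rfl⟩ := IsFractionRing.div_surjective (A := D) e
    obtain ⟨c, d, hd, rfl⟩ := IsFractionRing.div_surjective (A := D) z
    have hp0 : algebraMap D K p ≠ 0 := fun h => he0 (by simp [h])
    have hq0 : algebraMap D K q ≠ 0 := IsFractionRing.to_map_ne_zero_of_mem_nonZeroDivisors hq
    have hd0 : algebraMap D K d ≠ 0 := IsFractionRing.to_map_ne_zero_of_mem_nonZeroDivisors hd
    refine (Submodule.ne_bot_iff _).2 ⟨p * d, hH.2 ?_, fun h => ?_⟩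
    · have : (p * d) • (algebraMap D K c / algebraMap D K d) =
          (c * q) • (algebraMap D K p / algebraMap D K q) := by
        simp only [Algebra.smul_def, map_mul]
        field_simp
      rw [this]
      exact E.smul_mem _ he
    · have := congrArg (algebraMap D K) h
      rw [map_mul, map_zero] at this
      exact mul_ne_zero hp0 hd0 this
  have h1 := s.one_mem_finiteType_of_not_le h0 fun Q hQ hle => by
    obtain ⟨t, ht, h⟩ := hz Q hQ
    exact ht (hle (hH.2 h))
  refine s.finiteType.mem_of_one_mem (coeSubmodule_ne_bot h0) h1 ?_
  rintro _ ⟨t, ht, rfl⟩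
  rw [mul_comm]
  simpa [Algebra.smul_def] using hH.1 ht

end Tilde

end SemistarOperation

namespace SemistarOperation

variable {D K : Type*} [CommRing D] [Field K] [Algebra D K] [IsFractionRing D K]

/-! ### Local generators in a `⋆`-Dedekind domain -/

/-- In a `⋆`-Noetherian domain each nonzero ideal has the same closure as a finitely generated
subideal. -/
theorem IsNoetherianDomain.exists_fg_le {s : SemistarOperation D K} (hs : s.IsNoetherianDomain)
    {I : Ideal D} (hI : I ≠ ⊥) : ∃ J : Ideal D, J ≠ ⊥ ∧ J.FG ∧ J ≤ I ∧
      IsLocalization.coeSubmodule K I ≤ s (IsLocalization.coeSubmodule K J) := by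
  have hwf : WellFoundedGT {I : Ideal D // s.IsQuasiIdeal I} := by
    refine wellFoundedGT_iff_monotone_chain_condition.2 fun c => ?_
    obtain ⟨n, hn⟩ := hs ⟨fun n => (c n).1, fun _ _ h => c.monotone h⟩ fun n => (c n).2
    exact ⟨n, fun m hm => Subtype.ext (hn m hm)⟩
  obtain ⟨a, ha, ha0⟩ := (Submodule.ne_bot_iff I).1 hI
  have hspan : ∀ {y : D}, y ∈ I → Ideal.span {y} ≤ I := fun hy =>
    (Ideal.span_singleton_le_iff_mem _).2 hy
  have ha0' : Ideal.span {a} ≠ ⊥ := by simpa using ha0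
  obtain ⟨X, ⟨J, hJ0, hJ, hJI, hJX⟩, hmax⟩ := hwf.wf.has_min
    {X | ∃ J : Ideal D, J ≠ ⊥ ∧ J.FG ∧ J ≤ I ∧
      X.1 = contract (s (IsLocalization.coeSubmodule K J))}
    ⟨⟨_, s.isQuasiIdeal_contract ha0'⟩, Ideal.span {a}, ha0', ⟨{a}, by simp⟩, hspan ha, rfl⟩
  refine ⟨J, hJ0, hJ, hJI, ?_⟩
  rintro _ ⟨y, hy, rfl⟩
  have hJ'0 : J ⊔ Ideal.span {y} ≠ ⊥ := ne_bot_of_le_ne_bot hJ0 le_sup_left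
  have hnot := hmax ⟨_, s.isQuasiIdeal_contract hJ'0⟩
    ⟨J ⊔ Ideal.span {y}, hJ'0, Submodule.FG.sup hJ ⟨{y}, by simp⟩, sup_le hJI (hspan hy), rfl⟩
  have hle : X.1 ≤ contract (s (IsLocalization.coeSubmodule K (J ⊔ Ideal.span {y}))) := by
    rw [hJX]
    exact fun z hz => s.mono _ _ (coeSubmodule_ne_bot hJ0) (coeSubmodule_mono le_sup_left) hz
  have hy' : y ∈ contract (s (IsLocalization.coeSubmodule K (J ⊔ Ideal.span {y}))) :=
    s.le_contract_map hJ'0 (le_sup_right (a := J) (Ideal.mem_span_singleton_self y))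
  -- otherwise `J + yD` would have a strictly larger closure than `J`
  by_contra hcon
  refine hnot (lt_of_le_of_ne hle fun h => hcon ?_)
  have h' : X.1 = contract (s (IsLocalization.coeSubmodule K (J ⊔ Ideal.span {y}))) :=
    congrArg Subtype.val h
  rw [← h', hJX] at hy'
  exact hy'

/-- At a quasi-`⋆_f`-maximal ideal, a nonzero ideal of a `⋆`-Dedekind domain agrees with any
finitely generated subideal having the same closure. The invertibility of `J + yD` shows that
`J (J + yD)⁻¹` has `1` in its `⋆`-closure, hence in its `⋆_f`-closure by the chain condition. -/
theorem IsDedekindDomain.exists_mul_mem {s : SemistarOperation D K} (hs : s.IsDedekindDomain)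
    {J : Ideal D} (hJ0 : J ≠ ⊥) (hJ : J.FG) {y : D}
    (hy : algebraMap D K y ∈ s (IsLocalization.coeSubmodule K J))
    {Q : Ideal D} (hQ : s.finiteType.IsQuasiMaximal Q) : ∃ t ∉ Q, t * y ∈ J := by
  set J' : Ideal D := J ⊔ Ideal.span {y} with hJ'
  have hJ'0 : J' ≠ ⊥ := ne_bot_of_le_ne_bot hJ0 le_sup_left
  have hyJ' : y ∈ J' := le_sup_right (a := J) (Ideal.mem_span_singleton_self y)
  set F := IsLocalization.coeSubmodule K J with hF
  set F' := IsLocalization.coeSubmodule K J' with hF'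
  have hF0 : F ≠ ⊥ := coeSubmodule_ne_bot hJ0
  have hFF' : F ≤ F' := coeSubmodule_mono le_sup_left
  have hF'F : F' ≤ s F := by
    rintro _ ⟨z, hz, rfl⟩
    obtain ⟨u, hu, v, hv, rfl⟩ := Submodule.mem_sup.1 hz
    obtain ⟨c, rfl⟩ := Ideal.mem_span_singleton'.1 hv
    rw [Algebra.linearMap_apply, map_add]
    refine add_mem (s.le_map _ hF0 ⟨u, hu, rfl⟩) ?_
    rw [map_mul, ← Algebra.smul_def]
    exact Submodule.smul_mem _ c hy
  have h1F' : (1 : Submodule D K) ≤ 1 / F' := Submodule.one_le_one_div.2 (coeSubmodule_le_one J')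
  have hle1 : F * (1 / F') ≤ 1 := (mul_le_mul' hFF' le_rfl).trans Submodule.mul_one_div_le_one
  have hFE : F ≤ F * (1 / F') := by simpa using mul_le_mul' (le_refl F) h1F'
  have hF'E : F' ≤ F' * (1 / F') := by simpa using mul_le_mul' (le_refl F') h1F'
  have hE0 : F * (1 / F') ≠ ⊥ := ne_bot_of_le_ne_bot hF0 hFE
  have hE'0 : F' * (1 / F') ≠ ⊥ := ne_bot_of_le_ne_bot (coeSubmodule_ne_bot hJ'0) hF'E
  have hone : (1 : K) ∈ s (F * (1 / F')) := by
    have hinv : s.finiteType (F' * (1 / F')) = s.finiteType 1 :=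
      hs.2 J' hJ'0 (Submodule.FG.sup hJ ⟨{y}, by simp⟩)
    have h1 : (1 : K) ∈ s (F' * (1 / F')) := by
      refine s.finiteType_le hE'0 ?_
      rw [hinv]
      exact s.finiteType.le_map 1 one_ne_bot (Submodule.one_le.1 le_rfl)
    have h2 : F' * (1 / F') ≤ s (F * (1 / F')) :=
      (mul_le_mul' hF'F le_rfl).trans (s.map_mul_le_map_mul hF0 _)
    have h3 := s.mono _ _ hE'0 h2 h1
    rwa [s.idem _ hE0] at h3
  set H : Ideal D := contract (F * (1 / F')) with hH
  have hHE : IsLocalization.coeSubmodule K H = F * (1 / F') := coeSubmodule_contract hle1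
  have hH0 : H ≠ ⊥ := contract_ne_bot hE0 hle1
  obtain ⟨G, hG0, hG, hGH, hle⟩ := hs.1.exists_fg_le hH0
  have h1G : (1 : K) ∈ s (IsLocalization.coeSubmodule K G) := by
    have := s.mono _ _ (coeSubmodule_ne_bot hH0) hle
    rw [s.idem _ (coeSubmodule_ne_bot hG0)] at this
    rw [← hHE] at hone
    exact this hone
  obtain ⟨t, htH, htQ⟩ := Set.not_subset.1 (hQ.not_le hH0
    ((s.mem_finiteType_coeSubmodule hH0).2 ⟨G, hG0, hG, hGH, h1G⟩))
  refine ⟨t, htQ, ?_⟩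
  -- `(1 / F') y ⊆ D`, so `F (1 / F') y ⊆ F`
  have key : ∀ z ∈ F * (1 / F'), z * algebraMap D K y ∈ F := by
    intro z hz
    refine Submodule.mul_induction_on hz ?_ ?_
    · intro m hm n hn
      obtain ⟨d, hd⟩ := Submodule.mem_one.1
        (Submodule.mem_div_iff_forall_mul_mem.1 hn _ ⟨y, hyJ', rfl⟩)
      rw [Algebra.linearMap_apply] at hd
      rw [mul_assoc, ← hd, mul_comm, ← Algebra.smul_def]
      exact Submodule.smul_mem _ d hm
    · intro u v hu hv
      rw [add_mul]
      exact add_mem hu hv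
  have := key _ htH
  rw [Algebra.linearMap_apply, ← map_mul] at this
  exact algebraMap_mem_coeSubmodule.1 this

/-- In a `⋆`-Dedekind domain each nonzero ideal has a finitely generated subideal with the same
extension to `D_Q` for every quasi-`⋆_f`-maximal ideal `Q`. -/
theorem IsDedekindDomain.exists_fg_le {s : SemistarOperation D K} (hs : s.IsDedekindDomain)
    {I : Ideal D} (hI : I ≠ ⊥) : ∃ J : Ideal D, J ≠ ⊥ ∧ J.FG ∧ J ≤ I ∧
      ∀ Q, s.finiteType.IsQuasiMaximal Q → ∀ y ∈ I, ∃ t ∉ Q, t * y ∈ J := by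
  obtain ⟨J, hJ0, hJ, hJI, hle⟩ := hs.1.exists_fg_le hI
  exact ⟨J, hJ0, hJ, hJI, fun Q hQ y hy => hs.exists_mul_mem hJ0 hJ (hle ⟨y, hy, rfl⟩) hQ⟩

/-- In a `⋆`-Dedekind domain each nonzero ideal `I` has a principal extension `I D_Q`. -/
theorem IsDedekindDomain.exists_local_generator {s : SemistarOperation D K}
    (hs : s.IsDedekindDomain) {I : Ideal D} (hI : I ≠ ⊥) {Q : Ideal D}
    (hQ : s.finiteType.IsQuasiMaximal Q) :
    ∃ x ∈ I, ∀ y ∈ I, ∃ t ∉ Q, x ∣ t * y := by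
  obtain ⟨J, hJ0, hJ, hJI, hloc⟩ := hs.exists_fg_le hI
  set F := IsLocalization.coeSubmodule K J with hF
  have hFE : F ≤ F * (1 / F) := by
    simpa using mul_le_mul' (le_refl F) (Submodule.one_le_one_div.2 (coeSubmodule_le_one J))
  have hE0 : F * (1 / F) ≠ ⊥ := ne_bot_of_le_ne_bot (coeSubmodule_ne_bot hJ0) hFE
  have hHE : IsLocalization.coeSubmodule K (contract (F * (1 / F))) = F * (1 / F) :=
    coeSubmodule_contract Submodule.mul_one_div_le_one
  have hone : (1 : K) ∈ s.finiteType (F * (1 / F)) := by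
    have hinv : s.finiteType (F * (1 / F)) = s.finiteType 1 := hs.2 J hJ0 hJ
    rw [hinv]
    exact s.finiteType.le_map 1 one_ne_bot (Submodule.one_le.1 le_rfl)
  have hH0 : contract (F * (1 / F)) ≠ ⊥ := contract_ne_bot hE0 Submodule.mul_one_div_le_one
  rw [← hHE] at hone
  have hex : ∃ x ∈ J, ∃ w ∈ 1 / F, ∃ t ∉ Q, algebraMap D K x * w = algebraMap D K t := by
    by_contra! hcon
    refine hQ.not_le hH0 hone fun y hy => algebraMap_mem_coeSubmodule (K := K).1 ?_
    have hle : F * (1 / F) ≤ IsLocalization.coeSubmodule K Q := by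
      refine Submodule.mul_le.2 ?_
      rintro _ ⟨x, hx, rfl⟩ w hw
      obtain ⟨t, ht⟩ := Submodule.mem_one.1
        (Submodule.mem_div_iff_forall_mul_mem.1 hw _ ⟨x, hx, rfl⟩)
      rw [mul_comm, ← ht]
      refine algebraMap_mem_coeSubmodule.2 ?_
      by_contra htQ
      exact hcon x hx w hw t htQ (by rw [ht, mul_comm, Algebra.linearMap_apply])
    exact hle hy
  obtain ⟨x, hx, w, hw, t, ht, hxw⟩ := hex
  refine ⟨x, hJI hx, fun y hy => ?_⟩
  obtain ⟨u, hu, huy⟩ := hloc Q hQ y hy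
  refine ⟨t * u, hQ.isPrime.mul_notMem ht hu, ?_⟩
  obtain ⟨d, hd⟩ := Submodule.mem_one.1
    (Submodule.mem_div_iff_forall_mul_mem.1 hw _ ⟨u * y, huy, rfl⟩)
  refine ⟨d, IsFractionRing.injective D K ?_⟩
  rw [Algebra.linearMap_apply] at hd
  rw [mul_assoc, map_mul, ← hxw, map_mul _ x, hd]
  ring

end SemistarOperation

namespace SemistarOperation

variable {D K : Type*} [CommRing D] [Field K] [Algebra D K] [IsFractionRing D K]

/-! ### Finite character -/

/-- A local generator of a finitely generated ideal admits a common denominator. -/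
theorem _root_.Ideal.FG.exists_forall_dvd_mul {J Q : Ideal D} (hJ : J.FG) (hQ : Q.IsPrime) {x : D}
    (h : ∀ y ∈ J, ∃ t ∉ Q, x ∣ t * y) : ∃ t ∉ Q, ∀ y ∈ J, x ∣ t * y := by
  induction J, hJ using Submodule.fg_induction with
  | singleton z =>
    obtain ⟨t, ht, hz⟩ := h z (Submodule.mem_span_singleton_self z)
    refine ⟨t, ht, fun y hy => ?_⟩
    obtain ⟨c, rfl⟩ := Submodule.mem_span_singleton.1 hy
    rw [smul_eq_mul, mul_left_comm]
    exact hz.mul_left c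
  | sup N₁ N₂ _ _ h₁ h₂ =>
    obtain ⟨t, ht, hN₁⟩ := h₁ fun y hy => h y (le_sup_left (a := N₁) hy)
    obtain ⟨u, hu, hN₂⟩ := h₂ fun y hy => h y (le_sup_right (a := N₁) hy)
    refine ⟨t * u, hQ.mul_notMem ht hu, fun y hy => ?_⟩
    obtain ⟨v, hv, w, hw, rfl⟩ := Submodule.mem_sup.1 hy
    rw [mul_add]
    refine dvd_add ?_ ?_
    · rw [mul_comm t u, mul_assoc]
      exact (hN₁ v hv).mul_left u
    · rw [mul_assoc]
      exact (hN₂ w hw).mul_left t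

/-- If `p` generates `Q D_Q`, then every nonzero `a` divides a power of `p` in `D_Q`. Otherwise the
ideal of the `y` with `a ∣ y p ^ k` in `D_Q` for some `k` would lie in `Q`; dividing its local
generator by `p` gives another element of that ideal. -/
theorem IsDedekindDomain.exists_dvd_mul_pow {s : SemistarOperation D K} (hs : s.IsDedekindDomain)
    [IsDomain D] {Q : Ideal D} (hQ : s.finiteType.IsQuasiMaximal Q) {p : D} (hp : p ∈ Q)
    (hgen : ∀ y ∈ Q, ∃ t ∉ Q, p ∣ t * y) {a : D} (ha : a ≠ 0) :
    ∃ k : ℕ, ∃ t ∉ Q, a ∣ t * p ^ k := by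
  have hprime := hQ.isPrime
  let B : Ideal D :=
    { carrier := {y | ∃ k : ℕ, ∃ t ∉ Q, a ∣ t * (y * p ^ k)}
      zero_mem' := ⟨0, 1, (Ideal.ne_top_iff_one _).1 hprime.ne_top, by simp⟩
      add_mem' := by
        rintro y z ⟨k, t, ht, hy⟩ ⟨l, u, hu, hz⟩
        refine ⟨k + l, t * u, hprime.mul_notMem ht hu, ?_⟩
        have : t * u * ((y + z) * p ^ (k + l)) =
            (u * p ^ l) * (t * (y * p ^ k)) + (t * p ^ k) * (u * (z * p ^ l)) := by ring
        rw [this]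
        exact dvd_add (hy.mul_left _) (hz.mul_left _)
      smul_mem' := by
        rintro c y ⟨k, t, ht, hy⟩
        refine ⟨k, t, ht, ?_⟩
        have : t * (c • y * p ^ k) = c * (t * (y * p ^ k)) := by rw [smul_eq_mul]; ring
        rw [this]
        exact hy.mul_left _ }
  have hB : ∀ {y : D}, y ∈ B ↔ ∃ k : ℕ, ∃ t ∉ Q, a ∣ t * (y * p ^ k) := Iff.rfl
  have haB : a ∈ B := hB.2 ⟨0, 1, (Ideal.ne_top_iff_one _).1 hprime.ne_top, by simp⟩
  have hB0 : B ≠ ⊥ := (Submodule.ne_bot_iff _).2 ⟨a, haB, ha⟩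
  obtain ⟨x, hxB, hx⟩ := hs.exists_local_generator hB0 hQ
  have hx0 : x ≠ 0 := by
    rintro rfl
    obtain ⟨t, ht, h⟩ := hx a haB
    rcases mul_eq_zero.1 (zero_dvd_iff.1 h) with h | h
    · exact ht (h ▸ zero_mem Q)
    · exact ha h
  obtain ⟨k, t, ht, hdvd⟩ := hB.1 hxB
  have hxQ : x ∉ Q := by
    intro hxQ
    obtain ⟨u, hu, w, hw⟩ := hgen x hxQ
    have hwB : w ∈ B := by
      refine hB.2 ⟨k + 1, t, ht, ?_⟩
      have : t * (w * p ^ (k + 1)) = u * (t * (x * p ^ k)) := by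
        have : t * (w * p ^ (k + 1)) = t * p ^ k * (p * w) := by ring
        rw [this, ← hw]
        ring
      rw [this]
      exact hdvd.mul_left _
    obtain ⟨v, hv, c, hc⟩ := hx w hwB
    have : v * u = p * c := by
      refine mul_right_cancel₀ hx0 ?_
      calc v * u * x = v * (u * x) := by ring
        _ = p * (v * w) := by rw [hw]; ring
        _ = p * c * x := by rw [hc]; ring
    exact hprime.mul_notMem hv hu (this ▸ Q.mul_mem_right c hp)
  refine ⟨k, t * x, hprime.mul_notMem ht hxQ, ?_⟩
  rwa [mul_assoc]

/-- Over a nonzero `a`, a quasi-`⋆_f`-maximal ideal is separated from all the others by a single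
element. If `J ⊆ Q` is finitely generated with `J D_Q = Q D_Q`, then `t J ^ k ⊆ aD` for some `k`
and `t ∉ Q`, and `J` lies in no other quasi-`⋆_f`-maximal ideal. -/
theorem IsDedekindDomain.exists_separating {s : SemistarOperation D K} (hs : s.IsDedekindDomain)
    [IsDomain D] {Q : Ideal D} (hQ : s.finiteType.IsQuasiMaximal Q) {a : D} (ha : a ≠ 0) :
    ∃ t ∉ Q, ∀ Q', s.finiteType.IsQuasiMaximal Q' → a ∈ Q' → Q ≠ Q' → t ∈ Q' := by
  have hprime := hQ.isPrime
  obtain ⟨p, hp, hgen⟩ := hs.exists_local_generator hQ.prop.2.1 hQ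
  obtain ⟨J, -, hJ, hJQ, hloc⟩ := hs.exists_fg_le hQ.prop.2.1
  obtain ⟨k, t, ht, hdvd⟩ := hs.exists_dvd_mul_pow hQ hp hgen ha
  obtain ⟨u, hu, hJp⟩ := hJ.exists_forall_dvd_mul hprime fun y hy => hgen y (hJQ hy)
  refine ⟨t * u ^ k, hprime.mul_notMem ht fun h => hu (hprime.mem_of_pow_mem k h), ?_⟩
  intro Q' hQ' haQ' hne
  have hprime' := hQ'.isPrime
  have hJQ' : ¬ J ≤ Q' := by
    intro hle
    refine hne (Maximal.eq_of_le hQ hQ'.prop fun y hy => ?_)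
    obtain ⟨v, hv, hvy⟩ := hloc Q' hQ' y hy
    exact (hprime'.mem_or_mem (hle hvy)).resolve_left hv
  obtain ⟨j, hj, hjQ'⟩ := Set.not_subset.1 hJQ'
  have hmem : t * u ^ k * j ^ k ∈ Q' := by
    refine Ideal.mem_of_dvd Q' (hdvd.trans ?_) haQ'
    rw [mul_assoc, ← mul_pow]
    exact mul_dvd_mul_left t (pow_dvd_pow_of_dvd (hJp j hj) k)
  exact (hprime'.mem_or_mem hmem).resolve_right fun h => hjQ' (hprime'.mem_of_pow_mem k h)

/-- Each nonzero element of a `⋆`-Dedekind domain lies in finitely many quasi-`⋆_f`-maximal ideals: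
`a` and the separating elements generate an ideal that is locally the unit ideal, and finitely
many of them already do so. -/
theorem IsDedekindDomain.finite_setOf_mem {s : SemistarOperation D K} (hs : s.IsDedekindDomain)
    [IsDomain D] {a : D} (ha : a ≠ 0) :
    {Q : Ideal D | s.finiteType.IsQuasiMaximal Q ∧ a ∈ Q}.Finite := by
  set S := {Q : Ideal D | s.finiteType.IsQuasiMaximal Q ∧ a ∈ Q} with hS
  have hex : ∀ Q : S, ∃ t ∉ Q.1, ∀ Q', s.finiteType.IsQuasiMaximal Q' → a ∈ Q' → Q.1 ≠ Q' →
    t ∈ Q' := fun Q => hs.exists_separating Q.2.1 ha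
  choose t ht hsep using hex
  have hI0 : Ideal.span (insert a (Set.range t)) ≠ ⊥ :=
    (Submodule.ne_bot_iff _).2 ⟨a, Ideal.subset_span (Set.mem_insert _ _), ha⟩
  obtain ⟨J, -, hJ, hJI, hloc⟩ := hs.exists_fg_le hI0
  obtain ⟨T, hTI, hJT⟩ : ∃ T : Set S, T.Finite ∧ J ≤ Ideal.span (insert a (t '' T)) := by
    let f : Finset S → Ideal D := fun T => Ideal.span (insert a (t '' (T : Set S)))
    have hmono : Monotone f :=
      fun T T' h => Ideal.span_mono (Set.insert_subset_insert (Set.image_mono h))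
    have hf : ∀ T, f T ≤ sSup (Set.range f) := fun T => le_sSup (Set.mem_range_self T)
    have hle : Ideal.span (insert a (Set.range t)) ≤ sSup (Set.range f) := by
      rw [Ideal.span_le]
      rintro y (rfl | ⟨Q, rfl⟩)
      · exact hf ∅ (Ideal.subset_span (Set.mem_insert _ _))
      · exact hf {Q} (Ideal.subset_span (Set.mem_insert_of_mem _ ⟨Q, by simp, rfl⟩))
    obtain ⟨_, ⟨T, rfl⟩, hT⟩ := hJ.exists_le_of_le_sSup
      (Set.range_nonempty _) hmono.directed_le.directedOn_range (hJI.trans hle)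
    exact ⟨T, T.finite_toSet, hT⟩
  suffices T = Set.univ by
    exact Set.finite_coe_iff.1 (Set.finite_univ_iff.1 (this ▸ hTI))
  refine Set.eq_univ_of_forall fun Q => by_contra fun hQT => ?_
  obtain ⟨u, hu, hmem⟩ := hloc Q.1 Q.2.1 (t Q)
    (Ideal.subset_span (Set.mem_insert_of_mem _ ⟨Q, rfl⟩))
  have hle : Ideal.span (insert a (t '' T)) ≤ Q.1 := by
    rw [Ideal.span_le]
    rintro y (rfl | ⟨Q', hQ', rfl⟩)
    · exact Q.2.2
    · refine hsep Q' Q.1 Q.2.1 Q.2.2 fun h => hQT ?_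
      rwa [← Subtype.ext h]
  exact Q.2.1.isPrime.mul_notMem hu (ht Q) (hle (hJT hmem))

/-- In a `⋆`-Dedekind domain an ideal `I` and a nonzero `a ∈ I` admit one `b ∈ I` that generates
`I D_Q` for every quasi-`⋆_f`-maximal ideal `Q` containing `a`. As in the Chinese remainder theorem,
`b` is the sum of the local generators weighted by the separating elements. -/
theorem IsDedekindDomain.exists_common_generator {s : SemistarOperation D K}
    (hs : s.IsDedekindDomain) [IsDomain D] {I : Ideal D} {a : D} (haI : a ∈ I) (ha : a ≠ 0) :
    ∃ b ∈ I, ∀ Q, s.finiteType.IsQuasiMaximal Q → a ∈ Q → ∀ y ∈ I, ∃ t ∉ Q, b ∣ t * y := by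
  classical
  have hI : I ≠ ⊥ := (Submodule.ne_bot_iff _).2 ⟨a, haI, ha⟩
  set S := {Q : Ideal D | s.finiteType.IsQuasiMaximal Q ∧ a ∈ Q} with hS
  have : Fintype S := (hs.finite_setOf_mem ha).fintype
  have hex : ∀ Q : S, ∃ t ∉ Q.1, ∀ Q', s.finiteType.IsQuasiMaximal Q' → a ∈ Q' → Q.1 ≠ Q' →
    t ∈ Q' := fun Q => hs.exists_separating Q.2.1 ha
  choose e he hsep using hex
  have hex : ∀ Q : S, ∃ x ∈ I, ∀ y ∈ I, ∃ t ∉ Q.1, x ∣ t * y :=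
    fun Q => hs.exists_local_generator hI Q.2.1
  choose x hxI hgen using hex
  refine ⟨∑ Q, e Q * x Q, I.sum_mem fun Q _ => I.mul_mem_left _ (hxI Q), fun Q₀ hQ₀ haQ₀ y hy => ?_⟩
  have hprime := hQ₀.isPrime
  let Q : S := ⟨Q₀, hQ₀, haQ₀⟩
  -- the other summands vanish modulo `Q I D_Q`
  obtain ⟨r, hr, q, hq, hrq⟩ : ∃ r ∉ Q₀, ∃ q ∈ Q₀,
      r * ∑ Q' ∈ Finset.univ.erase Q, e Q' * x Q' = q * x Q := by
    refine Finset.sum_induction _ (fun z => ∃ r ∉ Q₀, ∃ q ∈ Q₀, r * z = q * x Q) ?_ ?_ ?_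
    · rintro z w ⟨r, hr, q, hq, h⟩ ⟨r', hr', q', hq', h'⟩
      refine ⟨r * r', hprime.mul_notMem hr hr', r' * q + r * q',
        add_mem (Q₀.mul_mem_left _ hq) (Q₀.mul_mem_left _ hq'), ?_⟩
      linear_combination r' * h + r * h'
    · exact ⟨1, (Ideal.ne_top_iff_one _).1 hprime.ne_top, 0, zero_mem _, by simp⟩
    · intro Q' hQ'
      have hne : Q'.1 ≠ Q₀ := fun h => Finset.ne_of_mem_erase hQ' (Subtype.ext h)
      obtain ⟨r, hr, c, hc⟩ := hgen Q (x Q') (hxI Q')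
      refine ⟨r, hr, e Q' * c, Q₀.mul_mem_right _ (hsep Q' Q₀ hQ₀ haQ₀ hne), ?_⟩
      linear_combination e Q' * hc
  have hsum : r * ∑ Q', e Q' * x Q' = (r * e Q + q) * x Q := by
    rw [← Finset.add_sum_erase _ _ (Finset.mem_univ Q), mul_add, hrq]
    ring
  have hunit : r * e Q + q ∉ Q₀ := fun h =>
    hprime.mul_notMem hr (he Q) ((Q₀.add_mem_iff_left hq).1 h)
  obtain ⟨t, ht, c, hc⟩ := hgen Q y hy
  refine ⟨(r * e Q + q) * t, hprime.mul_notMem hunit ht, r * c, ?_⟩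
  linear_combination (r * e Q + q) * hc - c * hsum

end SemistarOperation

namespace SemistarOperation

variable {D K : Type*} [CommRing D] [IsDomain D] [Field K] [Algebra D K] [IsFractionRing D K]

/-! ### Ideals generated up to `⋆~` by a prescribed element and one more -/

/-- Let `b` generate `I D_Q` at the finitely many `Q` containing `a`. At every other `Q` the element
`a` is a unit of `D_Q`, so that `aD + bD` and `I` have the same extension everywhere. -/
theorem IsDedekindDomain.tilde_eq_span_pair {s : SemistarOperation D K}
    (hs : s.IsDedekindDomain) {I : Ideal D} {a : D} (haI : a ∈ I) (ha : a ≠ 0) :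
    ∃ b ∈ s.tilde (IsLocalization.coeSubmodule K I),
      s.tilde (IsLocalization.coeSubmodule K I) =
        s.tilde (Submodule.span D {algebraMap D K a, b}) := by
  obtain ⟨b, hbI, hb⟩ := hs.exists_common_generator (K := K) haI ha
  have hI : I ≠ ⊥ := (Submodule.ne_bot_iff _).2 ⟨a, haI, ha⟩
  have ha0 : algebraMap D K a ≠ 0 := fun h =>
    ha (IsFractionRing.injective D K (h.trans (map_zero _).symm))
  refine ⟨algebraMap D K b, s.tilde.le_map _ (coeSubmodule_ne_bot hI) ⟨b, hbI, rfl⟩,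
    le_antisymm (fun z hz => ?_) (s.tilde.mono _ _ ?_ ?_)⟩
  · rw [mem_tilde_iff] at hz ⊢
    intro Q hQ
    obtain ⟨t, ht, y, hy, hyz⟩ := hz Q hQ
    have : ∃ u ∉ Q.asIdeal, a ∣ u * y ∨ b ∣ u * y := by
      by_cases haQ : a ∈ Q.asIdeal
      · obtain ⟨u, hu, h⟩ := hb _ hQ haQ y hy
        exact ⟨u, hu, .inr h⟩
      · exact ⟨a, haQ, .inl (dvd_mul_right a y)⟩
    obtain ⟨u, hu, h⟩ := this
    refine ⟨u * t, Q.isPrime.mul_notMem hu ht, ?_⟩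
    rw [mul_smul, ← hyz, Algebra.linearMap_apply, Algebra.smul_def, ← map_mul]
    rcases h with ⟨c, hc⟩ | ⟨c, hc⟩
    · rw [hc, mul_comm, map_mul, ← Algebra.smul_def]
      exact Submodule.smul_mem _ c (Submodule.subset_span (by simp))
    · rw [hc, mul_comm, map_mul, ← Algebra.smul_def]
      exact Submodule.smul_mem _ c (Submodule.subset_span (by simp))
  · exact (Submodule.ne_bot_iff _).2 ⟨_, Submodule.subset_span (Set.mem_insert _ _), ha0⟩
  · rw [Submodule.span_le]
    rintro _ (rfl | rfl)
    · exact ⟨a, haI, rfl⟩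
    · exact ⟨b, hbI, rfl⟩

/-- Taking the prescribed element in `QI` shows, as in Nakayama's lemma, that the other one alone
generates `I D_Q`. -/
theorem exists_local_generator_of_tilde_eq_span_pair
    {s : SemistarOperation D K}
    (h : ∀ I : Ideal D, I ≠ ⊥ → ∀ a ∈ I, a ≠ 0 →
      ∃ b ∈ s.tilde (IsLocalization.coeSubmodule K I),
        s.tilde (IsLocalization.coeSubmodule K I) =
          s.tilde (Submodule.span D {algebraMap D K a, b}))
    {I : Ideal D} (hI : I ≠ ⊥) {Q : Ideal D}
    (hQ : s.finiteType.IsQuasiMaximal Q) :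
    ∃ x ∈ I, ∀ y ∈ I, ∃ t ∉ Q, x ∣ t * y := by
  have hprime := hQ.isPrime
  obtain ⟨i, hi, hi0⟩ := (Submodule.ne_bot_iff I).1 hI
  obtain ⟨q, hq, hq0⟩ := (Submodule.ne_bot_iff Q).1 hQ.prop.2.1
  -- the prescribed element `q * i` lies in `QI`; `x = t b` is the second generator moved into `I`
  obtain ⟨b, hbI, hb⟩ := h I hI (q * i) (I.mul_mem_left q hi) (mul_ne_zero hq0 hi0)
  obtain ⟨t, ht, x, hxI, hx⟩ := (s.mem_tilde_iff.1 hbI) ⟨Q, hprime⟩ hQ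
  rw [Algebra.linearMap_apply, Algebra.smul_def] at hx
  have hcomb : ∀ y ∈ I, ∃ u ∉ Q, ∃ c d, u * t * y = c * t * (q * i) + d * x := by
    intro y hy
    have hmem := s.tilde.le_map _ (coeSubmodule_ne_bot hI) (⟨y, hy, rfl⟩ :
      algebraMap D K y ∈ IsLocalization.coeSubmodule K I)
    rw [hb] at hmem
    obtain ⟨u, hu, huy⟩ := (s.mem_tilde_iff.1 hmem) ⟨Q, hprime⟩ hQ
    obtain ⟨c, d, hcd⟩ := Submodule.mem_span_pair.1 huy
    refine ⟨u, hu, c, d, IsFractionRing.injective D K ?_⟩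
    simp only [Algebra.smul_def, map_mul, map_add] at hcd ⊢
    rw [hx]
    linear_combination -algebraMap D K t * hcd
  obtain ⟨u, hu, c, d, hcd⟩ := hcomb i hi
  have hw : u * t - c * t * q ∉ Q := fun hmem =>
    hprime.mul_notMem hu ht (by simpa using add_mem hmem (Q.mul_mem_left (c * t) hq))
  have hdvd : x ∣ (u * t - c * t * q) * i := ⟨d, by linear_combination hcd⟩
  refine ⟨x, hxI, fun y hy => ?_⟩
  obtain ⟨v, hv, e, f, hef⟩ := hcomb y hy
  refine ⟨(u * t - c * t * q) * (v * t), hprime.mul_notMem hw (hprime.mul_notMem hv ht), ?_⟩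
  rw [mul_assoc, hef, mul_add]
  refine dvd_add ?_ ((dvd_mul_left x f).mul_left _)
  have := hdvd.mul_left (e * t * q)
  convert this using 1
  ring

/-- For `I` finitely generated, a generator of `I D_Q` shows that `I I⁻¹` is not contained in `Q`.
This holds for all quasi-`⋆_f`-maximal `Q`, so the `⋆_f`-closure of `I I⁻¹` contains `1`. -/
theorem isPruferMultiplicationDomain_of_tilde_eq_span_pair
    {s : SemistarOperation D K}
    (h : ∀ I : Ideal D, I ≠ ⊥ → ∀ a ∈ I, a ≠ 0 →
      ∃ b ∈ s.tilde (IsLocalization.coeSubmodule K I),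
        s.tilde (IsLocalization.coeSubmodule K I) =
          s.tilde (Submodule.span D {algebraMap D K a, b})) :
    s.IsPruferMultiplicationDomain := by
  intro I hI hfg
  set F := IsLocalization.coeSubmodule K I with hF
  have hFE : F ≤ F * (1 / F) := by
    simpa using mul_le_mul' (le_refl F) (Submodule.one_le_one_div.2 (coeSubmodule_le_one I))
  have hE0 : F * (1 / F) ≠ ⊥ := ne_bot_of_le_ne_bot (coeSubmodule_ne_bot hI) hFE
  have hE1 : F * (1 / F) ≤ 1 := Submodule.mul_one_div_le_one
  have hHE : IsLocalization.coeSubmodule K (contract (F * (1 / F))) = F * (1 / F) :=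
    coeSubmodule_contract hE1
  have hH0 : contract (F * (1 / F)) ≠ ⊥ := contract_ne_bot hE0 Submodule.mul_one_div_le_one
  have hone : (1 : K) ∈ s.finiteType (F * (1 / F)) := by
    rw [← hHE]
    refine s.one_mem_finiteType_of_not_le hH0 fun Q hQ hle => ?_
    obtain ⟨x, hxI, hx⟩ := exists_local_generator_of_tilde_eq_span_pair h hI hQ
    obtain ⟨t, ht, hdvd⟩ := hfg.exists_forall_dvd_mul Q.isPrime hx
    have hx0 : x ≠ 0 := by
      rintro rfl
      obtain ⟨i, hi, hi0⟩ := (Submodule.ne_bot_iff I).1 hI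
      rcases mul_eq_zero.1 (zero_dvd_iff.1 (hdvd i hi)) with h | h
      · exact ht (h ▸ zero_mem Q.asIdeal)
      · exact hi0 h
    have hx0' : algebraMap D K x ≠ 0 := fun h =>
      hx0 (IsFractionRing.injective D K (h.trans (map_zero _).symm))
    -- `t / x` lies in `I⁻¹`, so that `t = x (t / x)` lies in `I I⁻¹`
    refine ht (hle ?_)
    have hinv : (algebraMap D K x)⁻¹ * algebraMap D K t ∈ 1 / F := by
      refine Submodule.mem_div_iff_forall_mul_mem.2 ?_
      rintro _ ⟨y, hy, rfl⟩
      obtain ⟨d, hd⟩ := hdvd y hy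
      refine Submodule.mem_one.2 ⟨d, ?_⟩
      rw [Algebra.linearMap_apply, mul_assoc, ← map_mul, hd, map_mul, inv_mul_cancel_left₀ hx0']
    have := Submodule.mul_mem_mul (algebraMap_mem_coeSubmodule.2 hxI) hinv
    rwa [mul_inv_cancel_left₀ hx0'] at this
  refine le_antisymm (s.finiteType.mono _ _ hE0 hE1) ?_
  have := s.finiteType.mono _ _ one_ne_bot (Submodule.one_le.2 hone)
  rwa [s.finiteType.idem _ hE0] at this

/-- If `a` and `b` generate the union of a chain of quasi-`⋆`-ideals up to `⋆~`, then `b` lies in the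
`⋆_f`-closure of the union, hence in the `⋆`-closure of a member of the chain; from there on the
chain is constant. -/
theorem isNoetherianDomain_of_tilde_eq_span_pair
    {s : SemistarOperation D K}
    (h : ∀ I : Ideal D, I ≠ ⊥ → ∀ a ∈ I, a ≠ 0 →
      ∃ b ∈ s.tilde (IsLocalization.coeSubmodule K I),
        s.tilde (IsLocalization.coeSubmodule K I) =
          s.tilde (Submodule.span D {algebraMap D K a, b})) :
    s.IsNoetherianDomain := by
  intro c hc
  have hd : DirectedOn (· ≤ ·) (Set.range c) := c.monotone.directed_le.directedOn_range
  set U := sSup (Set.range c) with hU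
  have hcU : ∀ n, c n ≤ U := fun n => le_sSup (Set.mem_range_self n)
  have hU0 : U ≠ ⊥ := ne_bot_of_le_ne_bot (hc 0).1 (hcU 0)
  obtain ⟨a, ha, ha0⟩ := (Submodule.ne_bot_iff _).1 (hc 0).1
  obtain ⟨b, hbU, hb⟩ := h U hU0 a (hcU 0 ha) ha0
  obtain ⟨J, hJ0, hJ, hJU, hbJ⟩ := (s.mem_finiteType_coeSubmodule hU0).1
    (s.tilde_le_finiteType (coeSubmodule_ne_bot hU0) hbU)
  obtain ⟨_, ⟨n, rfl⟩, hJn⟩ := hJ.exists_le_of_le_sSup (Set.range_nonempty _) hd hJU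
  have ha0' : algebraMap D K a ≠ 0 := fun h =>
    ha0 (IsFractionRing.injective D K (h.trans (map_zero _).symm))
  have hE0 : Submodule.span D {algebraMap D K a, b} ≠ ⊥ :=
    (Submodule.ne_bot_iff _).2 ⟨_, Submodule.subset_span (Set.mem_insert _ _), ha0'⟩
  have hn0 := coeSubmodule_ne_bot (K := K) (hc n).1
  have hle : Submodule.span D {algebraMap D K a, b} ≤
      s (IsLocalization.coeSubmodule K (c n)) := by
    rw [Submodule.span_le]
    rintro _ (rfl | rfl)
    · exact s.le_map _ hn0 ⟨a, c.monotone n.zero_le ha, rfl⟩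
    · exact s.mono _ _ (coeSubmodule_ne_bot hJ0) (coeSubmodule_mono hJn) hbJ
  refine ⟨n, fun m hnm => le_antisymm (c.monotone hnm) fun y hy => ?_⟩
  have hyU := s.tilde.le_map _ (coeSubmodule_ne_bot hU0) (⟨y, hcU m hy, rfl⟩ :
    algebraMap D K y ∈ IsLocalization.coeSubmodule K U)
  rw [hb] at hyU
  have hy' := s.mono _ _ hE0 hle (s.finiteType_le hE0 (s.tilde_le_finiteType hE0 hyU))
  rw [s.idem _ hn0] at hy'
  rw [(hc n).2]
  exact hy'

end SemistarOperation

theorem theorem4p27 {D K : Type*} [CommRing D] [IsDomain D] [Field K] [Algebra D K]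
    [IsFractionRing D K] (hD : ¬ IsField D) (star : SemistarOperation D K) :
    star.IsDedekindDomain ↔
      ∀ I : Ideal D, I ≠ ⊥ → ∀ a ∈ I, a ≠ 0 →
        ∃ b ∈ star.tilde (IsLocalization.coeSubmodule K I),
          star.tilde (IsLocalization.coeSubmodule K I) =
            star.tilde (Submodule.span D {algebraMap D K a, b}) :=
  ⟨fun h _ _ _ haI ha => h.tilde_eq_span_pair haI ha,
    fun h => ⟨SemistarOperation.isNoetherianDomain_of_tilde_eq_span_pair h,
      SemistarOperation.isPruferMultiplicationDomain_of_tilde_eq_span_pair h⟩⟩
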